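/- Let $k\ge 1$, $t\ge 1$ and $n\ge 4$ be integers with $n\ge (k+2)t$. For an integer $s$ with $1\le s\le \lfloor n/(k+2)\rfloor$ let $$H_s = K_s\vee\bigl(K_{n-(k+2)s}\cup (k+1)s\,K_1\bigr),$$ where $\cup$ is disjoint union and $\vee$ is the join (the disjoint union together with all edges between the two parts). For a finite simple graph $G$ let $\lambda_1(G)$ be the largest eigenvalue of its adjacency matrix. Call $G$ $t$-connected if its vertex connectivity, the minimum number of vertices whose deletion leaves a disconnected graph or a single vertex, is at least $t$. The leaf degree of a tree $T$ is the maximum, over the vertices $v$ of $T$, of the number of vertices of degree $1$ in $T$ that are adjacent to $v$ in $T$. Let $G$ be a $t$-connected simple graph on $n$ vertices, and suppose that $$\lambda_1(G)\ \ge\ \max\bigl\{\lambda_1(H_t),\ \lambda_1(H_{\lfloor n/(k+2)\rfloor})\bigr\}.$$ Then $G$ has a spanning tree with leaf degree at most $k$ unless $G\cong H_t$ or $G\cong H_{\lfloor n/(k+2)\rfloor}$; in these two exceptional cases $G$ has no such spanning tree. -/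

import Mathlib

namespace LeafDegree

open Classical in
/-- The largest eigenvalue of the adjacency matrix of a finite graph. The set is the set of
(real) eigenvalues of that matrix; it is finite, and nonempty when the graph has a vertex. -/
noncomputable def lambda1 {V : Type*} [Fintype V] (G : SimpleGraph V) : ℝ :=
  sSup (spectrum ℝ (G.adjMatrix ℝ))

/-- The join of two vertex-disjoint graphs: their disjoint union together with all edges between
the two parts. -/
def join {V W : Type*} (G : SimpleGraph V) (H : SimpleGraph W) : SimpleGraph (V ⊕ W) :=
  (G ⊕g H) ⊔ completeBipartiteGraph V W

/-- The graph `K_s ∨ (K_{n-(k+2)s} ∪ (k+1)s K_1)`. It is used only when `(k + 2) * s ≤ n`, so that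
the subtraction is exact and the graph has `n` vertices. -/
def extremalGraph (n k s : ℕ) :
    SimpleGraph (Fin s ⊕ (Fin (n - (k + 2) * s) ⊕ Fin ((k + 1) * s))) :=
  join (⊤ : SimpleGraph (Fin s))
    ((⊤ : SimpleGraph (Fin (n - (k + 2) * s))) ⊕g (⊥ : SimpleGraph (Fin ((k + 1) * s))))

/-- The vertex connectivity of a finite graph: the minimum number of vertices whose deletion
leaves a disconnected graph or a single vertex. -/
noncomputable def vertexConnectivity {V : Type*} [Fintype V] (G : SimpleGraph V) : ℕ :=
  sInf {m : ℕ | ∃ S : Set V, S.ncard = m ∧ (¬ (G.induce Sᶜ).Preconnected ∨ Sᶜ.ncard = 1)}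

/-- `G` is `t`-connected if its vertex connectivity is at least `t`. -/
def IsTConnected {V : Type*} [Fintype V] (G : SimpleGraph V) (t : ℕ) : Prop :=
  t ≤ vertexConnectivity G

/-- `u` is an end vertex of `T`: it has exactly one neighbour in `T`. -/
def IsEndVertex {V : Type*} (T : SimpleGraph V) (u : V) : Prop :=
  (T.neighborSet u).ncard = 1

/-- The leaf degree of `T`: the maximum over the vertices `v` of the number of end vertices of `T`
that are adjacent to `v` in `T`. -/
noncomputable def leafDegree {V : Type*} [Fintype V] (T : SimpleGraph V) : ℕ :=
  Finset.univ.sup fun v : V => {u : V | T.Adj v u ∧ IsEndVertex T u}.ncard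

/-- `G` has a spanning tree with leaf degree at most `k`. -/
def HasSpanningTreeLeafDegreeLE {V : Type*} [Fintype V] (G : SimpleGraph V) (k : ℕ) : Prop :=
  ∃ T : SimpleGraph V, T ≤ G ∧ T.IsTree ∧ leafDegree T ≤ k

end LeafDegree

open LeafDegree

/-! Write i(G − S) for the number of isolated vertices of G − S. Kaneko's criterion says that a
connected graph on at least four vertices has a spanning tree of leaf degree at most k iff i(G − S)
< (k+1)|S| for every nonempty S. If this fails for S with |S| = s, then G is a spanning subgraph of
H_s, so λ₁(G) ≤ λ₁(H_s), with equality only if G ≅ H_s. Counting vertices gives s ≤ ⌊n/(k+2)⌋;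
t-connectivity gives s ≥ t, since G − S has at least two isolated vertices.

λ₁(H_s) is a root of a cubic in x (`charCubic`) whose dependence on s, for fixed x, is unimodal
(`cubic_unimodal`). Hence λ₁(H_s) for s strictly between t and ⌊n/(k+2)⌋ lies below the maximum at
the two ends. So s is an end and G is one of the exceptions, which themselves violate the criterion.

For sufficiency of the criterion, Hall's theorem gives a spanning forest of stars with at most k+1
leaves, and only those with exactly k+1 are harmful. When their number is minimal, exchanges
(`IsAlmostGood.attach`, `IsAlmostGood.recentre`) show that any survivor leads to a set of centres
violating the criterion, or else to a three-vertex component, impossible in a connected graph on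
four or more vertices. For necessity, root the tree in S: at most k|S| isolated vertices are leaves,
and each other one has a child in S other than the root. -/

namespace LeafDegree

open Matrix

/-! ### Perron–Frobenius comparison for subgraphs -/

section Perron

variable {V W : Type*} [Fintype V] [Fintype W]

theorem mem_spectrum_matrix_iff [DecidableEq V] (A : Matrix V V ℝ) (x : ℝ) :
    x ∈ spectrum ℝ A ↔ ∃ v : V → ℝ, v ≠ 0 ∧ A *ᵥ v = x • v := by
  rw [← Matrix.spectrum_toLin', ← Module.End.hasEigenvalue_iff_mem_spectrum]
  constructor
  · intro h
    obtain ⟨v, hv⟩ := h.exists_hasEigenvector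
    exact ⟨v, hv.2, by simpa using hv.apply_eq_smul⟩
  · rintro ⟨v, hv, h⟩
    exact Module.End.hasEigenvalue_of_hasEigenvector
      (Module.End.hasEigenvector_iff.2 ⟨Module.End.mem_eigenspace_iff.2 (by simpa using h), hv⟩)

open Classical in
theorem adjMatrix_spectrum_finite (G : SimpleGraph V) : (spectrum ℝ (G.adjMatrix ℝ)).Finite := by
  rw [← Matrix.spectrum_toLin']
  exact Module.End.finite_spectrum _

open Classical in
theorem adjMatrix_spectrum_nonempty [Nonempty V] (G : SimpleGraph V) :
    (spectrum ℝ (G.adjMatrix ℝ)).Nonempty := by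
  have h : (G.adjMatrix ℝ).IsHermitian := by
    rw [Matrix.IsHermitian, Matrix.conjTranspose_eq_transpose_of_trivial]
    exact G.transpose_adjMatrix
  rw [h.spectrum_real_eq_range_eigenvalues]
  exact Set.range_nonempty _

open Classical in
theorem lambda1_eigenvector [Nonempty V] (G : SimpleGraph V) :
    ∃ v : V → ℝ, v ≠ 0 ∧ G.adjMatrix ℝ *ᵥ v = lambda1 G • v :=
  (mem_spectrum_matrix_iff _ _).1
    ((adjMatrix_spectrum_nonempty G).csSup_mem (adjMatrix_spectrum_finite G))

open Classical in
theorem le_lambda1 (G : SimpleGraph V) {x : ℝ} {v : V → ℝ} (hv : v ≠ 0)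
    (h : G.adjMatrix ℝ *ᵥ v = x • v) : x ≤ lambda1 G :=
  le_csSup (adjMatrix_spectrum_finite G).bddAbove ((mem_spectrum_matrix_iff _ _).2 ⟨v, hv, h⟩)

open Classical in
theorem lambda1_iso {G : SimpleGraph V} {H : SimpleGraph W} (e : G ≃g H) :
    lambda1 G = lambda1 H := by
  have h : H.adjMatrix ℝ = Matrix.reindexAlgEquiv ℝ ℝ e.toEquiv (G.adjMatrix ℝ) := by
    ext i j
    have := e.symm.map_adj_iff (v := i) (w := j)
    simp only [SimpleGraph.adjMatrix_apply, Matrix.coe_reindexAlgEquiv, Matrix.reindex_apply,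
      Matrix.submatrix_apply]
    exact if_congr this.symm rfl rfl
  rw [lambda1, lambda1, h, AlgEquiv.spectrum_eq]

open Classical in
/-- Comparison of the absolute value of an eigenvector of a subgraph with a positive
eigenvector. -/
theorem lambda1_mul_abs_le {G H : SimpleGraph V} (hGH : G ≤ H) {v : V → ℝ}
    (hv : G.adjMatrix ℝ *ᵥ v = lambda1 G • v) (i : V) :
    lambda1 G * |v i| ≤ (G.adjMatrix ℝ *ᵥ |v|) i ∧
      (G.adjMatrix ℝ *ᵥ |v|) i ≤ (H.adjMatrix ℝ *ᵥ |v|) i := by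
  constructor
  · have h := congrFun hv i
    simp only [Matrix.mulVec, dotProduct, Pi.smul_apply, smul_eq_mul] at h ⊢
    calc lambda1 G * |v i| ≤ |lambda1 G * v i| := by
          rw [abs_mul]; exact mul_le_mul_of_nonneg_right (le_abs_self _) (abs_nonneg _)
      _ = |∑ j, G.adjMatrix ℝ i j * v j| := by rw [h]
      _ ≤ ∑ j, |G.adjMatrix ℝ i j * v j| := Finset.abs_sum_le_sum_abs _ _
      _ = ∑ j, G.adjMatrix ℝ i j * |v| j := by
          refine Finset.sum_congr rfl fun j _ => ?_
          rw [abs_mul, Pi.abs_apply, SimpleGraph.adjMatrix_apply]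
          split_ifs <;> simp
  · refine Finset.sum_le_sum fun j _ => mul_le_mul_of_nonneg_right ?_ (abs_nonneg _)
    simp only [SimpleGraph.adjMatrix_apply]
    split_ifs with h1 h2 <;> first | exact le_rfl | exact zero_le_one | exact absurd (hGH h1) h2

open Classical in
theorem dotProduct_adjMatrix_mulVec {H : SimpleGraph V} {w : V → ℝ} {x : ℝ}
    (hw : H.adjMatrix ℝ *ᵥ w = x • w) (u : V → ℝ) :
    w ⬝ᵥ (H.adjMatrix ℝ *ᵥ u) = x * (w ⬝ᵥ u) := by
  rw [Matrix.dotProduct_mulVec, ← Matrix.mulVec_transpose, H.transpose_adjMatrix, hw,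
    smul_dotProduct, smul_eq_mul]

theorem dotProduct_abs_pos {v w : V → ℝ} (hw : ∀ i, 0 < w i) (hv : v ≠ 0) :
    0 < w ⬝ᵥ |v| := by
  obtain ⟨i, hi⟩ := Function.ne_iff.1 hv
  exact Finset.sum_pos' (fun j _ => mul_nonneg (hw j).le (abs_nonneg _))
    ⟨i, Finset.mem_univ _, mul_pos (hw i) (abs_pos.2 hi)⟩

open Classical in
-- Pairing `|v|`, for a top eigenvector `v` of `G`, with the positive eigenvector `w` of `H` gives
-- `lambda1 G * (w ⬝ᵥ |v|) ≤ x * (w ⬝ᵥ |v|)`, and the pairing is positive.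
theorem lambda1_le_of_le [Nonempty V] {G H : SimpleGraph V} (hGH : G ≤ H) {w : V → ℝ} {x : ℝ}
    (hpos : ∀ i, 0 < w i) (hw : H.adjMatrix ℝ *ᵥ w = x • w) : lambda1 G ≤ x := by
  obtain ⟨v, hv0, hv⟩ := lambda1_eigenvector G
  have h := dotProduct_adjMatrix_mulVec hw |v|
  have h2 : lambda1 G * (w ⬝ᵥ |v|) ≤ w ⬝ᵥ (H.adjMatrix ℝ *ᵥ |v|) := by
    rw [dotProduct, dotProduct, Finset.mul_sum]
    refine Finset.sum_le_sum fun i _ => ?_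
    have := lambda1_mul_abs_le hGH hv i
    have := mul_le_mul_of_nonneg_left (this.1.trans this.2) (hpos i).le
    simp only [Pi.abs_apply]
    linarith
  rw [h] at h2
  exact le_of_mul_le_mul_right h2 (dotProduct_abs_pos hpos hv0)

open Classical in
theorem lambda1_eq_of_pos [Nonempty V] {H : SimpleGraph V} {w : V → ℝ} {x : ℝ}
    (hpos : ∀ i, 0 < w i) (hw : H.adjMatrix ℝ *ᵥ w = x • w) : lambda1 H = x := by
  refine le_antisymm (lambda1_le_of_le le_rfl hpos hw) (le_lambda1 H ?_ hw)
  intro h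
  obtain ⟨i⟩ := ‹Nonempty V›
  exact (hpos i).ne' (congrFun h i)

open Classical in
-- Equality in the pairing makes `|v|` an eigenvector of `H`. A zero of it would spread along edges
-- to all vertices, so it is positive, and an edge of `H` missing from `G` would make some row sum
-- strictly smaller.
theorem eq_of_le_of_lambda1_eq [Nonempty V] {G H : SimpleGraph V} (hGH : G ≤ H)
    (hH : H.Preconnected) {w : V → ℝ} {x : ℝ}
    (hpos : ∀ i, 0 < w i) (hw : H.adjMatrix ℝ *ᵥ w = x • w) (hx : x ≤ lambda1 G) : G = H := by
  have hx' : lambda1 G = x := le_antisymm (lambda1_le_of_le hGH hpos hw) hx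
  obtain ⟨v, hv0, hv⟩ := lambda1_eigenvector G
  have hle := lambda1_mul_abs_le hGH hv
  have h := dotProduct_adjMatrix_mulVec hw |v|
  have hsum : ∑ i, w i * (lambda1 G * |v| i) = ∑ i, w i * (H.adjMatrix ℝ *ᵥ |v|) i := by
    rw [← dotProduct, ← dotProduct, h, hx', dotProduct, dotProduct, Finset.mul_sum]
    exact Finset.sum_congr rfl fun i _ => by ring
  have heq := (Finset.sum_eq_sum_iff_of_le fun i _ => mul_le_mul_of_nonneg_left
    ((hle i).1.trans (hle i).2) (hpos i).le).1 hsum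
  have heq' : ∀ i, lambda1 G * |v i| = (H.adjMatrix ℝ *ᵥ |v|) i := fun i =>
    mul_left_cancel₀ (hpos i).ne' (heq i (Finset.mem_univ _))
  have hzero : ∀ i j, H.Adj i j → v i = 0 → v j = 0 := by
    intro i j hij hi
    have h0 := heq' i
    rw [hi, abs_zero, mul_zero, Matrix.mulVec, dotProduct, eq_comm,
      Finset.sum_eq_zero_iff_of_nonneg] at h0
    · have := h0 j (Finset.mem_univ _)
      simpa [SimpleGraph.adjMatrix_apply, hij] using this
    · intro l _
      rw [SimpleGraph.adjMatrix_apply]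
      split_ifs <;> simp
  have hne : ∀ i, v i ≠ 0 := by
    intro i hi
    refine hv0 (funext fun j => ?_)
    obtain ⟨p⟩ := hH i j
    have : ∀ {a b : V} (p : H.Walk a b), v a = 0 → v b = 0 := by
      intro a b p
      induction p with
      | nil => exact id
      | cons hadj _ ih => exact fun ha => ih (hzero _ _ hadj ha)
    exact this p hi
  refine le_antisymm hGH fun i j hij => ?_
  by_contra hG
  have h1 : (G.adjMatrix ℝ *ᵥ |v|) i = (H.adjMatrix ℝ *ᵥ |v|) i :=
    le_antisymm (hle i).2 ((heq' i).symm.le.trans (hle i).1)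
  simp only [Matrix.mulVec, dotProduct] at h1
  have h2 := (Finset.sum_eq_sum_iff_of_le fun l _ => ?_).1 h1 j (Finset.mem_univ _)
  · simp [SimpleGraph.adjMatrix_apply, hij, hG] at h2
    exact hne j (abs_eq_zero.1 h2.symm)
  · refine mul_le_mul_of_nonneg_right ?_ (abs_nonneg _)
    simp only [SimpleGraph.adjMatrix_apply]
    split_ifs with h1 h2 <;> first | exact le_rfl | exact zero_le_one | exact absurd (hGH h1) h2

end Perron

/-! ### The largest eigenvalue of the extremal graphs -/

section Extremal

/-- The cubic whose largest root is the largest eigenvalue of `extremalGraph n k s`. -/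
noncomputable def charCubic (n k s x : ℝ) : ℝ :=
  x * (x + 1) * (x - n + 1) +
    (k + 1) * (x * (x + 1) * s + (n - 1 - x) * s ^ 2 - (k + 2) * s ^ 3)

/-- A common eigenvector of the extremal graph for a root `y` of `charCubic`. -/
noncomputable def extremalVec (n k s : ℕ) (y : ℝ) :
    Fin s ⊕ (Fin (n - (k + 2) * s) ⊕ Fin ((k + 1) * s)) → ℝ :=
  Sum.elim (fun _ => y * (y - n + (k + 2) * s + 1))
    (Sum.elim (fun _ => s * y) (fun _ => s * (y - n + (k + 2) * s + 1)))

theorem sum_ite_ne {m : ℕ} (i : Fin m) (a : ℝ) [DecidablePred fun j : Fin m => i ≠ j] :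
    ∑ j, (if i ≠ j then a else 0) = (m - 1) * a := by
  rw [← Finset.sum_filter, Finset.sum_const, nsmul_eq_mul]
  congr 1
  have h : (Finset.univ.filter fun j : Fin m => i ≠ j) = Finset.univ.erase i := by
    ext j
    simp [eq_comm]
  rw [h, Finset.card_erase_of_mem (Finset.mem_univ _), Finset.card_univ, Fintype.card_fin,
    Nat.cast_sub (by have := i.2; omega), Nat.cast_one]

open Classical in
-- The rows of the second clique and of the independent vertices hold for every `y`; the rows of
-- `K_s` are the cubic equation.
theorem extremalGraph_mulVec {n k s : ℕ} (hs : (k + 2) * s ≤ n) {y : ℝ}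
    (hy : charCubic n k s y = 0) :
    (extremalGraph n k s).adjMatrix ℝ *ᵥ extremalVec n k s y = y • extremalVec n k s y := by
  have hm : ((n - (k + 2) * s : ℕ) : ℝ) = n - (k + 2) * s := by
    rw [Nat.cast_sub hs]; push_cast; ring
  have hi : (((k + 1) * s : ℕ) : ℝ) = (k + 1) * s := by push_cast; ring
  rw [charCubic] at hy
  ext i
  simp only [Matrix.mulVec, dotProduct, Fintype.sum_sum_type, SimpleGraph.adjMatrix_apply,
    Pi.smul_apply, smul_eq_mul, ite_mul, one_mul, zero_mul]
  rcases i with i | i | i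
  · simp only [extremalGraph, join, extremalVec, SimpleGraph.sup_adj, SimpleGraph.sum_adj,
      completeBipartiteGraph_adj, SimpleGraph.top_adj, Sum.elim_inl, Sum.elim_inr, Sum.isLeft_inl,
      Sum.isRight_inl, Sum.isLeft_inr, Sum.isRight_inr, Bool.false_eq_true, and_false,
      or_false, false_or, and_true, if_true, sum_ite_ne, Finset.sum_const, Finset.card_univ,
      Fintype.card_fin, nsmul_eq_mul, hm, hi]
    linear_combination (-1 : ℝ) * hy
  · simp only [extremalGraph, join, extremalVec, SimpleGraph.sup_adj, SimpleGraph.sum_adj,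
      completeBipartiteGraph_adj, SimpleGraph.top_adj, Sum.elim_inl, Sum.elim_inr, Sum.isLeft_inl,
      Sum.isRight_inl, Sum.isLeft_inr, Sum.isRight_inr, Bool.false_eq_true, and_false,
      or_false, false_or, and_true, if_true, if_false, sum_ite_ne, Finset.sum_const,
      Finset.card_univ, Fintype.card_fin, nsmul_eq_mul, hm]
    ring
  · simp only [extremalGraph, join, extremalVec, SimpleGraph.sup_adj, SimpleGraph.sum_adj,
      completeBipartiteGraph_adj, SimpleGraph.bot_adj, Sum.elim_inl, Sum.elim_inr, Sum.isLeft_inl,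
      Sum.isRight_inl, Sum.isLeft_inr, Sum.isRight_inr, Bool.false_eq_true, and_false,
      or_false, false_or, and_true, if_true, if_false, Finset.sum_const,
      Finset.card_univ, Fintype.card_fin, nsmul_eq_mul]
    ring

theorem extremalVec_pos {n k s : ℕ} (hs1 : 1 ≤ s) {y : ℝ} (hy0 : 0 < y)
    (hy : (n : ℝ) - (k + 2) * s - 1 < y) (i) : 0 < extremalVec n k s y i := by
  have h1 : 0 < y - n + (k + 2) * s + 1 := by linarith
  have h2 : (0 : ℝ) < s := by exact_mod_cast hs1
  rcases i with i | i | i <;> simp only [extremalVec, Sum.elim_inl, Sum.elim_inr] <;> positivity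

theorem charCubic_pos {n k s : ℕ} (hs1 : 1 ≤ s) (hk : 1 ≤ k) (hs : (k + 2) * s ≤ n) :
    0 < charCubic n k s (n - 1) := by
  have h1 : ((k : ℝ) + 2) * s ≤ n := by exact_mod_cast hs
  have h2 : (1 : ℝ) ≤ s := by exact_mod_cast hs1
  have h3 : (1 : ℝ) ≤ k := by exact_mod_cast hk
  have h4 : (s : ℝ) + 1 < n := by nlinarith
  have h5 : ((k : ℝ) + 2) * s * s ≤ n * s := mul_le_mul_of_nonneg_right h1 (by linarith)
  have h6 : (n : ℝ) * s < n * (n - 1) := mul_lt_mul_of_pos_left (by linarith) (by linarith)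
  have h7 : charCubic n k s (n - 1) =
      (k + 1) * (s * ((n : ℝ) * (n - 1) - (k + 2) * s * s)) := by
    rw [charCubic]; ring
  rw [h7]
  have : (0 : ℝ) < (n : ℝ) * (n - 1) - (k + 2) * s * s := by linarith
  positivity

/-- Above the order of the clique `K_s ∨ K_{n-(k+2)s}`, the largest eigenvalue of the extremal
graph exceeds every point where the cubic is negative. -/
theorem exists_root_gt {n k s : ℕ} (hs1 : 1 ≤ s) (hk : 1 ≤ k) (hs : (k + 2) * s ≤ n)
    {p : ℝ} (hp : (n : ℝ) - (k + 2) * s + s - 1 ≤ p) (hpn : p ≤ n - 1)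
    (hneg : charCubic n k s p < 0) :
    ∃ y : ℝ, p < y ∧ y < n - 1 ∧ charCubic n k s y = 0 ∧
      lambda1 (extremalGraph n k s) = y ∧ ∀ i, 0 < extremalVec n k s y i := by
  have hcont : ContinuousOn (charCubic n k s) (Set.Icc p (n - 1)) := by
    unfold charCubic
    fun_prop
  -- The cubic changes sign between `p` and `n - 1`. Beyond `p` the vector attached to a root is
  -- positive, which identifies the root as the largest eigenvalue.
  obtain ⟨y, ⟨hy1, hy2⟩, hy⟩ := intermediate_value_Ioo hpn hcont ⟨hneg, charCubic_pos hs1 hk hs⟩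
  have h2 : (1 : ℝ) ≤ s := by exact_mod_cast hs1
  have h3 : ((k : ℝ) + 2) * s ≤ n := by exact_mod_cast hs
  have hpos := extremalVec_pos (n := n) (k := k) hs1 (y := y) (by linarith) (by linarith)
  have : Nonempty (Fin s) := ⟨⟨0, hs1⟩⟩
  exact ⟨y, hy1, hy2, hy, lambda1_eq_of_pos hpos (extremalGraph_mulVec hs hy), hpos⟩

/-- The point is the largest eigenvalue of the clique `K_s ∨ K_{n-(k+2)s}`, a starting point for the
search for the root. -/
theorem charCubic_clique_neg {n k s : ℕ} (hs1 : 1 ≤ s) :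
    charCubic n k s (n - (k + 2) * s + s - 1) < 0 := by
  have h : charCubic n k s (n - (k + 2) * s + s - 1) = -((k + 1) * (s : ℝ) ^ 3) := by
    rw [charCubic]; ring
  have h2 : (1 : ℝ) ≤ s := by exact_mod_cast hs1
  rw [h, neg_lt_zero]
  positivity

theorem exists_root {n k s : ℕ} (hs1 : 1 ≤ s) (hk : 1 ≤ k) (hs : (k + 2) * s ≤ n) :
    ∃ y : ℝ, 0 < y ∧ y < n - 1 ∧ charCubic n k s y = 0 ∧
      lambda1 (extremalGraph n k s) = y ∧ ∀ i, 0 < extremalVec n k s y i := by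
  have h2 : (1 : ℝ) ≤ s := by exact_mod_cast hs1
  have h3 : ((k : ℝ) + 2) * s ≤ n := by exact_mod_cast hs
  obtain ⟨y, h, h'⟩ := exists_root_gt hs1 hk hs le_rfl
    (by nlinarith [Nat.cast_nonneg (α := ℝ) k]) (charCubic_clique_neg hs1)
  exact ⟨y, by linarith, h'⟩

theorem lt_lambda1_of_charCubic_neg {n k s : ℕ} (hs1 : 1 ≤ s) (hk : 1 ≤ k)
    (hs : (k + 2) * s ≤ n) {x : ℝ} (hx : x < n - 1) (hneg : charCubic n k s x < 0) :
    x < lambda1 (extremalGraph n k s) := by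
  rcases le_total ((n : ℝ) - (k + 2) * s + s - 1) x with h | h
  · obtain ⟨y, hy, -, -, h', -⟩ := exists_root_gt hs1 hk hs h hx.le hneg
    exact h' ▸ hy
  · have h2 : (1 : ℝ) ≤ s := by exact_mod_cast hs1
    obtain ⟨y, hy, -, -, h', -⟩ := exists_root_gt hs1 hk hs le_rfl
      (by nlinarith [Nat.cast_nonneg (α := ℝ) k]) (charCubic_clique_neg hs1)
    exact h' ▸ h.trans_lt hy

/-- A cubic `P s + d s² - K s³` with `P, K > 0` is strictly unimodal on the positive axis. -/
theorem cubic_unimodal {P d K a b c : ℝ} (hP : 0 < P) (hK : 0 < K) (ha : 0 < a) (hab : a < b)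
    (hbc : b < c) :
    P * a + d * a ^ 2 - K * a ^ 3 < P * b + d * b ^ 2 - K * b ^ 3 ∨
      P * c + d * c ^ 2 - K * c ^ 3 < P * b + d * b ^ 2 - K * b ^ 3 := by
  by_contra! h
  obtain ⟨h1, h2⟩ := h
  -- `e1` and `e2` are the two divided differences and `e3` is the second one. Substituting `e3` in
  -- `e1` gives `P ≤ -K * (a * b + c * (a + b)) < 0`.
  have e1 : P + d * (a + b) - K * (a ^ 2 + a * b + b ^ 2) ≤ 0 := by
    by_contra! h
    nlinarith [mul_pos (sub_pos.2 hab) h]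
  have e2 : 0 ≤ P + d * (b + c) - K * (b ^ 2 + b * c + c ^ 2) := by
    by_contra! h
    nlinarith [mul_pos (sub_pos.2 hbc) (neg_pos.2 h)]
  have e3 : K * (a + b + c) ≤ d := by
    by_contra! h
    nlinarith [mul_pos (sub_pos.2 (hab.trans hbc)) (sub_pos.2 h)]
  have e4 : K * (a + b + c) * (a + b) ≤ d * (a + b) :=
    mul_le_mul_of_nonneg_right e3 (by linarith)
  have hb : 0 < b := ha.trans hab
  have hc : 0 < c := hb.trans hbc
  have : 0 < K * (a * b + c * (a + b)) := by positivity
  nlinarith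

/-- At `x = λ₁(H_s)` the cubic for `s` vanishes, so by unimodality in the parameter the cubic for
`t` or for `f` is negative at `x`, and its largest root lies further right. -/
theorem lambda1_extremalGraph_lt_max {n k t s f : ℕ} (hk : 1 ≤ k) (ht : 1 ≤ t) (hts : t < s)
    (hsf : s < f) (hf : (k + 2) * f ≤ n) :
    lambda1 (extremalGraph n k s) <
      max (lambda1 (extremalGraph n k t)) (lambda1 (extremalGraph n k f)) := by
  have hsn : (k + 2) * s ≤ n := (Nat.mul_le_mul_left _ hsf.le).trans hf
  have htn : (k + 2) * t ≤ n := (Nat.mul_le_mul_left _ hts.le).trans hsn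
  obtain ⟨x, hx0, hxn, hx, hl, -⟩ := exists_root (n := n) (ht.trans hts.le) hk hsn
  rw [hl, lt_max_iff]
  have key := cubic_unimodal (P := x * (x + 1)) (d := n - 1 - x) (K := (k : ℝ) + 2) (a := t)
    (b := s) (c := f) (by positivity) (by positivity) (by exact_mod_cast ht)
    (by exact_mod_cast hts) (by exact_mod_cast hsf)
  have hk0 : (0 : ℝ) < k + 1 := by positivity
  rw [charCubic] at hx
  refine key.imp (fun h => ?_) (fun h => ?_)
  · refine lt_lambda1_of_charCubic_neg ht hk htn hxn ?_
    rw [charCubic]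
    linarith [mul_lt_mul_of_pos_left h hk0]
  · refine lt_lambda1_of_charCubic_neg (ht.trans (hts.le.trans hsf.le)) hk hf hxn ?_
    rw [charCubic]
    linarith [mul_lt_mul_of_pos_left h hk0]

theorem extremalGraph_preconnected {n k s : ℕ} (hs1 : 1 ≤ s) :
    (extremalGraph n k s).Preconnected := by
  have h : ∀ i, (extremalGraph n k s).Reachable (Sum.inl ⟨0, hs1⟩) i := by
    rintro (i | i)
    · by_cases hi : (⟨0, hs1⟩ : Fin s) = i
      · rw [hi]
      · exact SimpleGraph.Adj.reachable (by simp [extremalGraph, join, hi])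
    · exact SimpleGraph.Adj.reachable (by simp [extremalGraph, join])
  exact fun i j => (h i).symm.trans (h j)

theorem lambda1_le_extremalGraph {n k s : ℕ} (hs1 : 1 ≤ s) (hk : 1 ≤ k) (hs : (k + 2) * s ≤ n)
    {G : SimpleGraph (Fin s ⊕ (Fin (n - (k + 2) * s) ⊕ Fin ((k + 1) * s)))}
    (hG : G ≤ extremalGraph n k s) :
    lambda1 G ≤ lambda1 (extremalGraph n k s) ∧
      (lambda1 (extremalGraph n k s) ≤ lambda1 G → G = extremalGraph n k s) := by
  obtain ⟨x, hx0, hxn, hx, hl, hpos⟩ := exists_root (n := n) hs1 hk hs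
  have : Nonempty (Fin s) := ⟨⟨0, hs1⟩⟩
  rw [hl]
  exact ⟨lambda1_le_of_le hG hpos (extremalGraph_mulVec hs hx),
    eq_of_le_of_lambda1_eq hG (extremalGraph_preconnected hs1) hpos (extremalGraph_mulVec hs hx)⟩

end Extremal

/-! ### Star factors from Hall's theorem -/

section StarFactor

variable {V : Type*} [Fintype V]

open Classical in
/-- The vertices outside `S` that are isolated once `S` is deleted. -/
noncomputable def isolatedAfter (G : SimpleGraph V) (S : Finset V) : Finset V :=
  Finset.univ.filter fun v => v ∉ S ∧ ∀ w, G.Adj v w → w ∈ S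

theorem mem_isolatedAfter {G : SimpleGraph V} {S : Finset V} {v : V} :
    v ∈ isolatedAfter G S ↔ v ∉ S ∧ ∀ w, G.Adj v w → w ∈ S := by
  simp [isolatedAfter]

open Classical in
-- Let `I` be the vertices of `X` without neighbours in `X`. Deleting `N(I)` isolates `I`, which
-- bounds `I.card`; the rest of `X` lies in `N(X)` and is disjoint from `N(I)`.
theorem card_le_mul_card_neighbors {G : SimpleGraph V} {c : ℕ} (hc : 1 ≤ c)
    (hiso : ∀ v, ∃ w, G.Adj v w)
    (h : ∀ S : Finset V, S.Nonempty → (isolatedAfter G S).card ≤ c * S.card) (X : Finset V) :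
    X.card ≤ c * (X.biUnion fun v => G.neighborFinset v).card := by
  set I := X.filter fun v => ∀ w, G.Adj v w → w ∉ X with hI
  set NI := I.biUnion fun v => G.neighborFinset v with hNI
  have h1 : I.card ≤ c * NI.card := by
    rcases I.eq_empty_or_nonempty with h0 | ⟨v, hv⟩
    · simp [h0]
    · obtain ⟨w, hw⟩ := hiso v
      refine le_trans (Finset.card_le_card fun u hu => ?_)
        (h NI ⟨w, Finset.mem_biUnion.2 ⟨v, hv, by simpa using hw⟩⟩)
      rw [mem_isolatedAfter]
      refine ⟨fun hu' => ?_, fun z hz => Finset.mem_biUnion.2 ⟨u, hu, by simpa using hz⟩⟩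
      obtain ⟨y, hy, hyu⟩ := Finset.mem_biUnion.1 hu'
      exact (Finset.mem_filter.1 hy).2 u (by simpa using hyu) (Finset.mem_filter.1 hu).1
  have h2 : Disjoint NI (X \ I) := by
    rw [Finset.disjoint_left]
    intro u hu hu'
    obtain ⟨y, hy, hyu⟩ := Finset.mem_biUnion.1 hu
    exact (Finset.mem_filter.1 hy).2 u (by simpa using hyu) (Finset.mem_sdiff.1 hu').1
  have h3 : NI ∪ (X \ I) ⊆ X.biUnion fun v => G.neighborFinset v := by
    refine Finset.union_subset (Finset.biUnion_subset_biUnion_of_subset_left _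
      (Finset.filter_subset _ _)) fun u hu => ?_
    rw [Finset.mem_sdiff, hI, Finset.mem_filter, not_and] at hu
    have := hu.2 hu.1
    push Not at this
    obtain ⟨w, hw, hwX⟩ := this
    exact Finset.mem_biUnion.2 ⟨w, hwX, by simpa using hw.symm⟩
  have h4 := Finset.card_le_card h3
  rw [Finset.card_union_of_disjoint h2] at h4
  have h5 : I.card + (X \ I).card = X.card := by
    rw [add_comm]; exact Finset.card_sdiff_add_card_eq_card (Finset.filter_subset _ _)
  calc X.card = I.card + (X \ I).card := h5.symm
    _ ≤ c * NI.card + c * (X \ I).card := Nat.add_le_add h1 (Nat.le_mul_of_pos_left _ hc)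
    _ = c * (NI.card + (X \ I).card) := by ring
    _ ≤ _ := Nat.mul_le_mul_left _ h4

open Classical in
theorem exists_bounded_neighbor_map {G : SimpleGraph V} {c : ℕ} (hc : 1 ≤ c)
    (hiso : ∀ v, ∃ w, G.Adj v w)
    (h : ∀ S : Finset V, S.Nonempty → (isolatedAfter G S).card ≤ c * S.card) :
    ∃ f : V → V, (∀ v, G.Adj v (f v)) ∧
      ∀ w, (Finset.univ.filter fun v => f v = w).card ≤ c := by
  -- Hall's theorem with `c` copies of every vertex on the right-hand side.
  obtain ⟨F, hF, hFt⟩ := (Finset.all_card_le_biUnion_card_iff_exists_injective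
    (fun v => G.neighborFinset v ×ˢ (Finset.univ : Finset (Fin c)))).1 (by
      intro X
      refine (card_le_mul_card_neighbors hc hiso h X).trans ?_
      have : (X.biUnion fun v => G.neighborFinset v) ×ˢ (Finset.univ : Finset (Fin c)) ⊆
          X.biUnion fun v => G.neighborFinset v ×ˢ (Finset.univ : Finset (Fin c)) := by
        rintro ⟨w, i⟩ hw
        simpa using hw
      have := Finset.card_le_card this
      rwa [Finset.card_product, Finset.card_univ, Fintype.card_fin, mul_comm] at this)
  refine ⟨fun v => (F v).1, fun v => ?_, fun w => ?_⟩
  · simpa using hFt v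
  · calc _ ≤ (Finset.univ : Finset (Fin c)).card := by
          refine Finset.card_le_card_of_injOn (fun v => (F v).2) (fun _ _ => Finset.mem_univ _) ?_
          intro u hu v hv huv
          simp only [Finset.coe_filter, Finset.mem_univ, true_and, Set.mem_ofPred_eq] at hu hv
          exact hF (Prod.ext (hu.trans hv.symm) huv)
      _ = c := by simp

open Classical in
/-- `g` partitions the vertices into stars of `G` with at most `c` leaves: the fixed points are
the centres, and every other vertex is mapped to the centre of its star. -/
structure IsStarSystem (G : SimpleGraph V) (c : ℕ) (g : V → V) : Prop where
  adj : ∀ v, g v ≠ v → G.Adj v (g v)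
  idem : ∀ v, g (g v) = g v
  card_le : ∀ w, (Finset.univ.filter fun u => u ≠ w ∧ g u = w).card ≤ c

open Classical in
/-- The centres of stars without leaves. -/
noncomputable def trivialCentres (g : V → V) : Finset V :=
  Finset.univ.filter fun v => g v = v ∧ ∀ u, g u = v → u = v

theorem mem_trivialCentres {g : V → V} {v : V} :
    v ∈ trivialCentres g ↔ g v = v ∧ ∀ u, g u = v → u = v := by
  simp [trivialCentres]

open Classical in
theorem IsStarSystem.improve {G : SimpleGraph V} {c : ℕ} (hc : 2 ≤ c) {f g : V → V}
    (hf : ∀ v, G.Adj v (f v)) (hfc : ∀ w, (Finset.univ.filter fun v => f v = w).card ≤ c)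
    (hg : IsStarSystem G c g) {v : V} (hv : v ∈ trivialCentres g) :
    ∃ g', IsStarSystem G c g' ∧ (trivialCentres g' ⊆ (trivialCentres g).erase v ∨
      (trivialCentres g').card ≤ (trivialCentres g).card ∧
      (Finset.univ.filter fun u => g' u ≠ f u) ⊆
        (Finset.univ.filter fun u => g u ≠ f u).erase v) := by
  obtain ⟨hvv, hvu⟩ := mem_trivialCentres.1 hv
  obtain ⟨hadj, hidem, hcard⟩ := hg
  have hvw : G.Adj v (f v) := hf v
  have hne : v ≠ f v := hvw.ne
  generalize hw : f v = w at hvw hne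
  by_cases hgw : g w = w
  · by_cases hlt : (Finset.univ.filter fun u => u ≠ w ∧ g u = w).card < c
    · refine ⟨fun u => if u = v then w else g u, ⟨?_, ?_, ?_⟩, Or.inl ?_⟩
      · grind
      · grind
      · intro x
        by_cases hx : x = w
        · subst hx
          refine le_trans (Finset.card_le_card (t := insert v
            (Finset.univ.filter fun u => u ≠ x ∧ g u = x)) ?_)
            ((Finset.card_insert_le _ _).trans hlt)
          intro u; simp; grind
        · refine le_trans (Finset.card_le_card ?_) (hcard x)
          intro u; simp; grind
      · intro x; simp only [Finset.mem_erase, mem_trivialCentres]; grind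
    · have hex : ∃ x, x ≠ w ∧ g x = w ∧ f x ≠ w := by
        by_contra! hno
        have : insert v (Finset.univ.filter fun u => u ≠ w ∧ g u = w) ⊆
            Finset.univ.filter fun u => f u = w := by
          intro u; simp; grind
        have h1 := (Finset.card_le_card this).trans (hfc w)
        rw [Finset.card_insert_of_notMem (by simp; grind)] at h1
        omega
      obtain ⟨x, hxw, hgx, hfx⟩ := hex
      refine ⟨fun u => if u = v then w else if u = x then x else g u, ⟨?_, ?_, ?_⟩,
        Or.inr ⟨?_, ?_⟩⟩
      · grind
      · grind
      · intro y
        by_cases hy : y = w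
        · subst hy
          refine le_trans (Finset.card_le_card (t := insert v
            ((Finset.univ.filter fun u => u ≠ y ∧ g u = y).erase x)) ?_)
            ((Finset.card_insert_le _ _).trans ?_)
          · intro u; simp; grind
          · rw [Finset.card_erase_add_one (by simp; grind)]
            exact hcard y
        · refine le_trans (Finset.card_le_card ?_) (hcard y)
          intro u; simp; grind
      · refine le_trans (Finset.card_le_card (t := insert x ((trivialCentres g).erase v)) ?_)
          ((Finset.card_insert_le _ _).trans ?_)
        · intro y; simp only [Finset.mem_insert, Finset.mem_erase, mem_trivialCentres]; grind
        · rw [Finset.card_erase_add_one hv]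
      · intro y; simp; grind
  · have hwz : g (g w) = g w := hidem w
    generalize hz : g w = z at hgw hwz
    have hadjz : G.Adj w z := hz ▸ hadj w (by rw [hz]; exact hgw)
    -- Here `w` is a leaf of the star at `z`. If `z` has another leaf, `w` can leave to form a star
    -- with `v`; otherwise `v`, `w`, `z` form a star centred at `w`, which needs `2 ≤ c`.
    by_cases hy : ∃ y, y ≠ w ∧ y ≠ z ∧ g y = z
    · obtain ⟨y, hyw, hyz, hgy⟩ := hy
      refine ⟨fun u => if u = w then v else g u, ⟨?_, ?_, ?_⟩, Or.inl ?_⟩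
      · intro u hu
        have := hvw.symm
        grind
      · grind
      · intro x
        by_cases hx : x = v
        · refine le_trans (Finset.card_le_card (t := {w}) ?_) (by simp; omega)
          intro u; simp; grind
        · refine le_trans (Finset.card_le_card ?_) (hcard x)
          intro u; simp; grind
      · intro x; simp only [Finset.mem_erase, mem_trivialCentres]; grind
    · push Not at hy
      refine ⟨fun u => if u = v ∨ u = z ∨ u = w then w else g u, ⟨?_, ?_, ?_⟩, Or.inl ?_⟩
      · intro u hu
        have := hadjz.symm
        grind
      · grind
      · intro x
        by_cases hx : x = w
        · refine le_trans (Finset.card_le_card (t := {v, z}) ?_)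
            (Finset.card_le_two.trans hc)
          intro u; simp; grind
        · refine le_trans (Finset.card_le_card ?_) (hcard x)
          intro u; simp; grind
      · intro x; simp only [Finset.mem_erase, mem_trivialCentres]; grind

open Classical in
theorem exists_starFactor {G : SimpleGraph V} {c : ℕ} (hc : 2 ≤ c)
    (hiso : ∀ v, ∃ w, G.Adj v w)
    (h : ∀ S : Finset V, S.Nonempty → (isolatedAfter G S).card ≤ c * S.card) :
    ∃ g, IsStarSystem G c g ∧ ∀ v, g v = v → ∃ u, u ≠ v ∧ g u = v := by
  obtain ⟨f, hf, hfc⟩ := exists_bounded_neighbor_map (by omega) hiso h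
  -- A lexicographic order: trivial centres first, then disagreements with `f`, of which there are
  -- at most `Fintype.card V`.
  let key : (V → V) → ℕ := fun g => (Fintype.card V + 1) * (trivialCentres g).card +
    (Finset.univ.filter fun u => g u ≠ f u).card
  have hid : IsStarSystem G c id :=
    ⟨fun v hv => absurd rfl hv, fun _ => rfl, fun w => by
      rw [Finset.card_eq_zero.2 (by ext u; simp)]; exact Nat.zero_le _⟩
  obtain ⟨g, hgS, hmin⟩ := Finset.exists_min_image
    (Finset.univ.filter fun g : V → V => IsStarSystem G c g) key ⟨id, by simpa using hid⟩
  simp only [Finset.mem_filter, Finset.mem_univ, true_and] at hgS hmin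
  refine ⟨g, hgS, fun v hv => ?_⟩
  by_contra! hno
  have hvt : v ∈ trivialCentres g :=
    mem_trivialCentres.2 ⟨hv, fun u hu => by_contra fun hne => hno u hne hu⟩
  obtain ⟨g', hg', hlt⟩ := hgS.improve hc hf hfc hvt
  have hkey := hmin g' hg'
  have hbound : (Finset.univ.filter fun u => g' u ≠ f u).card ≤ Fintype.card V :=
    Finset.card_le_univ _
  rcases hlt with hlt | ⟨hle, hlt⟩
  · have h1 := Finset.card_le_card hlt
    have h2 := Finset.card_erase_add_one hvt
    have h3 := Nat.mul_le_mul_left (Fintype.card V + 1) (show (trivialCentres g').card + 1 ≤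
      (trivialCentres g).card by omega)
    simp only [key] at hkey
    rw [mul_add, mul_one] at h3
    omega
  · have h1 := Finset.card_le_card hlt
    have h2 := Finset.card_erase_add_one (show v ∈ Finset.univ.filter fun u => g u ≠ f u by
      simpa [hv] using (hf v).ne)
    have h3 := Nat.mul_le_mul_left (Fintype.card V + 1) hle
    simp only [key] at hkey
    omega

end StarFactor

theorem exists_adj_mem_notMem {V : Type*} {G : SimpleGraph V} (hG : G.Preconnected) {T : Finset V} {a b : V}
    (ha : a ∈ T) (hb : b ∉ T) : ∃ x ∈ T, ∃ y ∉ T, G.Adj x y := by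
  obtain ⟨p⟩ := hG a b
  have : ∀ {a b : V} (_ : G.Walk a b), a ∈ T → b ∉ T → ∃ x ∈ T, ∃ y ∉ T, G.Adj x y := by
    intro a b p
    induction p with
    | nil => exact fun h h' => absurd h h'
    | @cons x y _ hadj _ ih =>
      intro hx hz
      by_cases hy : y ∈ T
      · exact ih hy hz
      · exact ⟨x, hx, y, hy, hadj⟩
  exact this p ha hb

/-! ### Removing full stars by exchanges -/

section Linking

variable {V : Type*} [Fintype V]

open Classical in
/-- The end vertices of `F` whose only neighbour is `x`. -/
noncomputable def leafSet (F : SimpleGraph V) (x : V) : Finset V :=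
  Finset.univ.filter fun y => F.Adj y x ∧ ∀ z, F.Adj y z → z = x

theorem mem_leafSet {F : SimpleGraph V} {x y : V} :
    y ∈ leafSet F x ↔ F.Adj y x ∧ ∀ z, F.Adj y z → z = x := by
  simp [leafSet]

theorem coe_leafSet (T : SimpleGraph V) (v : V) :
    {u : V | T.Adj v u ∧ IsEndVertex T u} = (leafSet T v : Set V) := by
  ext u
  simp only [Set.mem_ofPred_eq, Finset.mem_coe, mem_leafSet, IsEndVertex, Set.ncard_eq_one]
  constructor
  · rintro ⟨hvu, a, ha⟩
    have h1 : v = a := by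
      have : v ∈ T.neighborSet u := hvu.symm
      rwa [ha] at this
    refine ⟨hvu.symm, fun z hz => ?_⟩
    have : z ∈ T.neighborSet u := hz
    rw [ha] at this
    exact this.trans h1.symm
  · rintro ⟨huv, hz⟩
    refine ⟨huv.symm, v, Set.ext fun z => ⟨hz z, ?_⟩⟩
    rintro rfl
    exact huv

/-- `v` is the centre of a component of `F` that is a star with `k + 1` leaves. -/
def IsFullStar (F : SimpleGraph V) (k : ℕ) (v : V) : Prop :=
  (leafSet F v).card = k + 1 ∧ ∀ w, F.Adj v w → w ∈ leafSet F v

/-- A spanning forest without isolated vertices in which leaf degrees above `k` occur only at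
centres of components that are stars with `k + 1` leaves. -/
structure IsAlmostGood (G : SimpleGraph V) (k : ℕ) (F : SimpleGraph V) : Prop where
  le : F ≤ G
  acyclic : F.IsAcyclic
  exists_adj : ∀ v, ∃ w, F.Adj v w
  leaf : ∀ v, (leafSet F v).card ≤ k ∨ IsFullStar F k v

open Classical in
/-- The centres of the components that are stars with `k + 1` leaves. -/
noncomputable def fullCentres (F : SimpleGraph V) (k : ℕ) : Finset V :=
  Finset.univ.filter (IsFullStar F k)

theorem mem_fullCentres {F : SimpleGraph V} {k : ℕ} {v : V} :
    v ∈ fullCentres F k ↔ IsFullStar F k v := by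
  simp [fullCentres]

theorem isAcyclic_of_forall_adj_leaf {F : SimpleGraph V}
    (h : ∀ a b, F.Adj a b → a ∈ leafSet F b ∨ b ∈ leafSet F a) : F.IsAcyclic := by
  have key : ∀ a b, F.Adj a b → a ∈ leafSet F b → F.IsBridge s(a, b) := by
    intro a b hab hl
    rw [SimpleGraph.isBridge_iff]
    rintro ⟨p⟩
    cases p with
    | nil => exact hab.ne rfl
    | cons hadj _ =>
      rw [SimpleGraph.deleteEdges_adj] at hadj
      exact hadj.2 (by simp [(mem_leafSet.1 hl).2 _ hadj.1])
  rw [SimpleGraph.isAcyclic_iff_forall_adj_isBridge]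
  intro a b hab
  rcases h a b hab with hl | hl
  · exact key a b hab hl
  · rw [Sym2.eq_swap]; exact key b a hab.symm hl

/-- A leaf of `F'` already has a neighbour in `F`, which must be its only neighbour in `F'`. Thus
adding edges creates no leaves. -/
theorem leafSet_mono {F F' : SimpleGraph V} (hF : ∀ v, ∃ w, F.Adj v w) (h : F ≤ F') (x : V) :
    leafSet F' x ⊆ leafSet F x := by
  intro y hy
  rw [mem_leafSet] at hy ⊢
  obtain ⟨w, hw⟩ := hF y
  exact ⟨hy.2 w (h hw) ▸ hw, fun z hz => hy.2 z (h hz)⟩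

theorem IsFullStar.not_leaf {F : SimpleGraph V} {k : ℕ} (hk : 1 ≤ k) {v : V}
    (hv : IsFullStar F k v) (x : V) : v ∉ leafSet F x := by
  intro hx
  have : (leafSet F v).card ≤ ({x} : Finset V).card := Finset.card_le_card fun y hy => by
    rw [Finset.mem_singleton]
    exact (mem_leafSet.1 hx).2 y (mem_leafSet.1 hy).1.symm
  rw [hv.1, Finset.card_singleton] at this
  omega

open Classical in
theorem exists_isAlmostGood {G : SimpleGraph V} {k : ℕ} (hk : 1 ≤ k)
    (hiso : ∀ v, ∃ w, G.Adj v w)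
    (h : ∀ S : Finset V, S.Nonempty → (isolatedAfter G S).card ≤ (k + 1) * S.card) :
    ∃ F, IsAlmostGood G k F := by
  obtain ⟨g, hg, hgc⟩ := exists_starFactor (by omega : 2 ≤ k + 1) hiso h
  obtain ⟨hadj, hidem, hcard⟩ := hg
  have hF : ∀ a b, (SimpleGraph.fromRel fun a b => g a = b).Adj a b ↔
      a ≠ b ∧ (g a = b ∨ g b = a) := fun a b => SimpleGraph.fromRel_adj _ a b
  generalize (SimpleGraph.fromRel fun a b => g a = b) = F at hF
  refine ⟨F, ⟨?_, isAcyclic_of_forall_adj_leaf ?_, ?_, ?_⟩⟩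
  · intro a b hab
    rw [hF] at hab
    obtain ⟨hne, h1 | h1⟩ := hab
    · have := hadj a; rw [h1] at this; exact this hne.symm
    · have := hadj b; rw [h1] at this; exact (this hne).symm
  · intro a b hab
    simp only [mem_leafSet]
    grind
  · intro v
    by_cases hv : g v = v
    · obtain ⟨u, hu, huv⟩ := hgc v hv
      exact ⟨u, (hF v u).2 ⟨hu.symm, Or.inr huv⟩⟩
    · exact ⟨g v, (hF v _).2 ⟨fun h => hv h.symm, Or.inl rfl⟩⟩
  · intro v
    by_cases hv : g v = v
    · have h1 : leafSet F v = Finset.univ.filter fun u => u ≠ v ∧ g u = v := by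
        ext y
        simp only [mem_leafSet, Finset.mem_filter, Finset.mem_univ, true_and]
        grind
      rcases Nat.lt_or_ge (leafSet F v).card (k + 1) with h2 | h2
      · left; omega
      · right
        refine ⟨le_antisymm (h1 ▸ hcard v) h2, fun w hw => ?_⟩
        rw [h1]
        simp only [Finset.mem_filter, Finset.mem_univ, true_and]
        grind
    · left
      refine le_trans (Finset.card_le_card (t := {g v}) fun y hy => ?_) (by simpa using hk)
      rw [mem_leafSet] at hy
      rw [Finset.mem_singleton]
      grind

theorem not_reachable_of_fullStar {F : SimpleGraph V} {k : ℕ} {u v w : V}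
    (hv : IsFullStar F k v) (hu : u ∈ leafSet F v) (hwv : w ≠ v) (hw : w ∉ leafSet F v) :
    ¬ F.Reachable u w := by
  have key : ∀ {a b : V} (_ : F.Walk a b), (a = v ∨ a ∈ leafSet F v) →
      (b = v ∨ b ∈ leafSet F v) := by
    intro a b p
    induction p with
    | nil => exact id
    | cons hadj _ ih =>
      intro ha
      refine ih ?_
      rcases ha with rfl | ha
      · exact Or.inr (hv.2 _ hadj)
      · exact Or.inl ((mem_leafSet.1 ha).2 _ hadj)
  rintro ⟨p⟩
  rcases key p (Or.inr hu) with h | h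
  · exact hwv h
  · exact hw h

open Classical in
-- Adding the edge `uw` stops `u` from being a leaf, so `v` is no longer full; since leaf sets only
-- shrink and `w` was not full, no new full star arises.
theorem IsAlmostGood.attach {G F : SimpleGraph V} {k : ℕ} (hk : 1 ≤ k) (hF : IsAlmostGood G k F)
    {u v w : V} (hv : IsFullStar F k v) (hu : u ∈ leafSet F v) (hwv : w ≠ v)
    (hw : w ∉ leafSet F v) (huw : G.Adj u w) (hwf : ¬ IsFullStar F k w) :
    ∃ F', IsAlmostGood G k F' ∧ (fullCentres F' k).card < (fullCentres F k).card := by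
  have hac := SimpleGraph.IsAcyclic.sup_edge_of_not_reachable
    (not_reachable_of_fullStar hv hu hwv hw) hF.acyclic
  have hle : F ≤ F ⊔ SimpleGraph.edge u w := le_sup_left
  have hadj : ∀ a b, (F ⊔ SimpleGraph.edge u w).Adj a b ↔
      F.Adj a b ∨ (a = u ∧ b = w ∨ a = w ∧ b = u) := by
    intro a b
    rw [SimpleGraph.sup_adj, SimpleGraph.edge_adj]
    have := huw.ne
    grind
  generalize F ⊔ SimpleGraph.edge u w = F' at hac hle hadj
  have hmono := leafSet_mono hF.exists_adj hle
  have huw' := huw.ne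
  have hu' := mem_leafSet.1 hu
  have huf : ¬ IsFullStar F k u := fun h => h.not_leaf hk v hu
  have hnew : ∀ x, (leafSet F' x).card ≤ k ∨ (x ≠ v ∧ IsFullStar F k x ∧ IsFullStar F' k x) := by
    intro x
    rcases hF.leaf x with hx | hx
    · exact Or.inl ((Finset.card_le_card (hmono x)).trans hx)
    · by_cases hdrop : leafSet F' x = leafSet F x
      · right
        refine ⟨?_, hx, hdrop ▸ hx.1, fun y hy => ?_⟩
        · rintro rfl
          rw [← hdrop, mem_leafSet] at hu
          exact hwv (hu.2 w ((hadj u w).2 (by simp)))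
        · rw [hdrop]
          rcases (hadj x y).1 hy with h | ⟨rfl, -⟩ | ⟨rfl, -⟩
          · exact hx.2 y h
          · exact absurd hx huf
          · exact absurd hx hwf
      · left
        have := Finset.card_lt_card (Finset.ssubset_iff_subset_ne.2 ⟨hmono x, hdrop⟩)
        have := hx.1
        omega
  refine ⟨F', ⟨?_, hac, ?_, ?_⟩, ?_⟩
  · intro a b hab
    rcases (hadj a b).1 hab with h | ⟨rfl, rfl⟩ | ⟨rfl, rfl⟩
    · exact hF.le h
    · exact huw
    · exact huw.symm
  · intro x
    obtain ⟨y, hy⟩ := hF.exists_adj x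
    exact ⟨y, hle hy⟩
  · exact fun x => (hnew x).imp_right fun h => h.2.2
  · refine Finset.card_lt_card (Finset.ssubset_iff_of_subset ?_ |>.2
      ⟨v, mem_fullCentres.2 hv, ?_⟩)
    · intro x hx
      rw [mem_fullCentres] at hx ⊢
      rcases hnew x with h | h
      · have := hx.1; omega
      · exact h.2.1
    · intro hx
      rw [mem_fullCentres] at hx
      rcases hnew v with h | h
      · have := hx.1; omega
      · exact h.1 rfl

open Classical in
/-- The leaf `u` of a full star centred at `v` is moved to the leaf `u'`. -/
theorem IsAlmostGood.recentre {G F : SimpleGraph V} {k : ℕ} (hk : 1 ≤ k)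
    (hF : IsAlmostGood G k F) {u u' v : V} (hv : IsFullStar F k v) (hu : u ∈ leafSet F v)
    (hu' : u' ∈ leafSet F v) (huu : G.Adj u u') :
    ∃ F', IsAlmostGood G k F' ∧ ¬ IsFullStar F' k v ∧
      (if k = 1 then IsFullStar F' k u' ∧ leafSet F' u' = {u, v} else ¬ IsFullStar F' k u') ∧
      ∀ x, x ≠ v → x ≠ u' → (IsFullStar F' k x ↔ IsFullStar F k x) ∧
        leafSet F' x = leafSet F x := by
  have hne := huu.ne
  have hul := mem_leafSet.1 hu
  have hul' := mem_leafSet.1 hu'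
  have hvl : ∀ y, F.Adj v y ↔ y ∈ leafSet F v :=
    fun y => ⟨hv.2 y, fun h => (mem_leafSet.1 h).1.symm⟩
  have huv : u ≠ v := hul.1.ne
  have huv' : u' ≠ v := hul'.1.ne
  have hadj : ∀ a b, ((F \ SimpleGraph.edge v u) ⊔ SimpleGraph.edge u u').Adj a b ↔
      (F.Adj a b ∧ ¬ (a = v ∧ b = u) ∧ ¬ (a = u ∧ b = v)) ∨
        (a = u ∧ b = u' ∨ a = u' ∧ b = u) := by
    intro a b
    rw [SimpleGraph.sup_adj, SimpleGraph.sdiff_adj, SimpleGraph.edge_adj, SimpleGraph.edge_adj]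
    by_cases hab : a = b
    · subst hab
      simp
      grind
    · simp only [hab, ne_eq, not_false_eq_true, and_true, not_or]
  have hac : ((F \ SimpleGraph.edge v u) ⊔ SimpleGraph.edge u u').IsAcyclic := by
    refine SimpleGraph.IsAcyclic.sup_edge_of_not_reachable ?_ (hF.acyclic.anti sdiff_le)
    rintro ⟨p⟩
    cases p with
    | nil => exact hne rfl
    | cons h _ =>
      rw [SimpleGraph.sdiff_adj, SimpleGraph.edge_adj] at h
      have := hul.2 _ h.1
      exact h.2 ⟨Or.inr ⟨rfl, this⟩, this ▸ huv⟩
  generalize (F \ SimpleGraph.edge v u) ⊔ SimpleGraph.edge u u' = F' at hadj hac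
  have hsymm : ∀ a b, F.Adj a b → F.Adj b a := fun a b h => h.symm
  have hN : ∀ x y, x ≠ u → x ≠ u' → x ≠ v → (F'.Adj x y ↔ F.Adj x y) := by
    intro x y h1 h2 h3
    rw [hadj]
    simp [h1, h2, h3]
  have hNu : ∀ y, F'.Adj u y ↔ y = u' := by intro y; rw [hadj]; grind
  have hNu' : ∀ y, F'.Adj u' y ↔ y = u ∨ y = v := by intro y; rw [hadj]; grind
  have hNv : ∀ y, F'.Adj v y ↔ y ∈ leafSet F v ∧ y ≠ u := by intro y; rw [hadj, ← hvl]; grind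
  have hL : ∀ x, x ≠ v → x ≠ u' → leafSet F' x = leafSet F x := by
    intro x hxv hxu'
    ext y
    rw [mem_leafSet, mem_leafSet]
    by_cases h1 : y = u
    · subst h1; grind
    · by_cases h2 : y = u'
      · subst h2; grind
      · by_cases h3 : y = v
        · subst h3; grind
        · simp only [hN y _ h1 h2 h3]
  have hfull : ∀ x, x ≠ v → x ≠ u' → (IsFullStar F' k x ↔ IsFullStar F k x) := by
    intro x hxv hxu'
    by_cases hxu : x = u
    · subst hxu
      refine iff_of_false (fun h => ?_) (fun h => h.not_leaf hk v hu)
      refine h.not_leaf hk u' (mem_leafSet.2 ⟨?_, fun z hz => (hNu z).1 hz⟩)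
      exact (hNu u').2 rfl
    · rw [IsFullStar, IsFullStar, hL x hxv hxu']
      simp only [hN x _ hxu hxu' hxv]
  have hcardv : (leafSet F' v).card + 2 ≤ k + 1 := by
    have : leafSet F' v ⊆ ((leafSet F v).erase u).erase u' := by
      intro y hy
      rw [mem_leafSet] at hy
      have h1 : y ≠ u' := by
        rintro rfl
        exact huv (hy.2 u ((hNu' u).2 (Or.inl rfl)))
      have h2 := (hNv y).1 hy.1.symm
      exact Finset.mem_erase.2 ⟨h1, Finset.mem_erase.2 ⟨h2.2, h2.1⟩⟩
    have h1 := Finset.card_le_card this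
    have h2 := Finset.card_erase_add_one hu
    have h3 := Finset.card_erase_add_one (Finset.mem_erase.2 ⟨hne.symm, hu'⟩)
    have h4 := hv.1
    omega
  -- After the move `v` keeps `k` neighbours, so it becomes a leaf at `u'` exactly when `k = 1`.
  have hu'leaf : leafSet F' u' = if k = 1 then {u, v} else {u} := by
    have hv2 : v ∈ leafSet F' u' ↔ k = 1 := by
      have h2 : (leafSet F v = {u, u'}) ↔ k = 1 := by
        constructor
        · intro h
          have := hv.1
          rw [h, Finset.card_pair hne] at this
          omega
        · rintro rfl
          refine (Finset.eq_of_subset_of_card_le ?_ ?_).symm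
          · intro y hy; simp only [Finset.mem_insert, Finset.mem_singleton] at hy; grind
          · rw [hv.1, Finset.card_pair hne]
      rw [← h2, mem_leafSet]
      constructor
      · intro h
        ext y
        simp only [Finset.mem_insert, Finset.mem_singleton]
        grind
      · intro h
        simp only [hNv, h, Finset.mem_insert, Finset.mem_singleton]
        grind
    have hu2 : u ∈ leafSet F' u' := mem_leafSet.2 ⟨(hNu u').2 rfl, fun z => (hNu z).1⟩
    have hsub : ∀ y, y ∈ leafSet F' u' → y = u ∨ y = v :=
      fun y hy => (hNu' y).1 (mem_leafSet.1 hy).1.symm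
    ext y
    split_ifs <;> simp only [Finset.mem_insert, Finset.mem_singleton] <;> grind
  have hu'full : if k = 1 then IsFullStar F' k u' ∧ leafSet F' u' = {u, v}
      else ¬ IsFullStar F' k u' := by
    split_ifs with h
    · rw [if_pos h] at hu'leaf
      refine ⟨⟨?_, fun y hy => ?_⟩, hu'leaf⟩
      · rw [hu'leaf, Finset.card_pair huv, h]
      · rw [hu'leaf]; simpa using (hNu' y).1 hy
    · rw [if_neg h] at hu'leaf
      intro hf
      have := hf.1
      rw [hu'leaf, Finset.card_singleton] at this
      omega
  refine ⟨F', ⟨?_, hac, ?_, ?_⟩, fun h => ?_, hu'full, fun x h1 h2 => ⟨hfull x h1 h2, hL x h1 h2⟩⟩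
  · intro a b hab
    rcases (hadj a b).1 hab with h | ⟨rfl, rfl⟩ | ⟨rfl, rfl⟩
    · exact hF.le h.1
    · exact huu
    · exact huu.symm
  · intro x
    by_cases hxu : x = u
    · exact ⟨u', by rw [hxu, hNu]⟩
    · by_cases hxv : x = v
      · exact ⟨u', by rw [hxv, hNv]; exact ⟨hu', hne.symm⟩⟩
      · obtain ⟨y, hy⟩ := hF.exists_adj x
        exact ⟨y, by rw [hadj]; simp [hxu, hxv, hy]⟩
  · intro x
    by_cases hxv : x = v
    · left; rw [hxv]; omega
    · by_cases hxu' : x = u'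
      · rw [hxu']
        by_cases h : k = 1
        · rw [if_pos h] at hu'full; exact Or.inr hu'full.1
        · left; rw [hu'leaf, if_neg h]; simpa using hk
      · rw [hfull x hxv hxu', hL x hxv hxu']
        exact hF.leaf x
  · have := h.1
    omega

/-- An almost good forest with as few full stars as possible. -/
def IsOptimal (G : SimpleGraph V) (k : ℕ) (F : SimpleGraph V) : Prop :=
  IsAlmostGood G k F ∧
    ∀ F', IsAlmostGood G k F' → (fullCentres F k).card ≤ (fullCentres F' k).card

open Classical in
-- For `k ≥ 2` the move would destroy a full star, against optimality. For `k = 1` the full star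
-- merely changes its centre from `v` to `u'`.
theorem IsOptimal.recentre {G F : SimpleGraph V} {k : ℕ} (hk : 1 ≤ k)
    (hF : IsOptimal G k F) {u u' v : V} (hv : IsFullStar F k v) (hu : u ∈ leafSet F v)
    (hu' : u' ∈ leafSet F v) (huu : G.Adj u u') :
    ∃ F', IsOptimal G k F' ∧ ¬ IsFullStar F' k v ∧ IsFullStar F' k u' ∧
      leafSet F' u' = {u, v} ∧
      ∀ x, x ≠ v → x ≠ u' → (IsFullStar F' k x ↔ IsFullStar F k x) ∧
        leafSet F' x = leafSet F x := by
  obtain ⟨F', hF', hv', hfull, hsame⟩ := hF.1.recentre hk hv hu hu' huu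
  have hvm := mem_fullCentres.2 hv
  have hcard := Finset.card_erase_add_one hvm
  split_ifs at hfull with h
  · refine ⟨F', ⟨hF', fun F'' hF'' => le_trans ?_ (hF.2 F'' hF'')⟩, hv', hfull.1, hfull.2, hsame⟩
    rw [← hcard]
    refine (Finset.card_le_card (t := insert u' ((fullCentres F k).erase v)) fun x hx => ?_).trans
      (Finset.card_insert_le _ _)
    rw [mem_fullCentres] at hx
    rw [Finset.mem_insert, Finset.mem_erase, mem_fullCentres]
    by_cases hxu : x = u'
    · exact Or.inl hxu
    · have hxv : x ≠ v := by rintro rfl; exact hv' hx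
      exact Or.inr ⟨hxv, (hsame x hxv hxu).1.1 hx⟩
  · exfalso
    have h1 := hF.2 F' hF'
    have h2 : fullCentres F' k ⊆ (fullCentres F k).erase v := by
      intro x hx
      rw [mem_fullCentres] at hx
      rw [Finset.mem_erase, mem_fullCentres]
      have hxu : x ≠ u' := by rintro rfl; exact hfull hx
      have hxv : x ≠ v := by rintro rfl; exact hv' hx
      exact ⟨hxv, (hsame x hxv hxu).1.1 hx⟩
    have := Finset.card_le_card h2
    omega

theorem IsOptimal.full_of_adj {G F : SimpleGraph V} {k : ℕ} (hk : 1 ≤ k)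
    (hF : IsOptimal G k F) {u v w : V} (hv : IsFullStar F k v) (hu : u ∈ leafSet F v)
    (hwv : w ≠ v) (hw : w ∉ leafSet F v) (huw : G.Adj u w) : IsFullStar F k w := by
  by_contra hwf
  obtain ⟨F', hF', hlt⟩ := hF.1.attach hk hv hu hwv hw huw hwf
  exact absurd (hF.2 F' hF') (not_le.2 hlt)

/-- If two leaves of `w` were adjacent, recentring there would keep the forest optimal and `v` full
but make `w` not full, against `IsOptimal.full_of_adj`. -/
theorem IsOptimal.independent_of_adj {G F : SimpleGraph V} {k : ℕ} (hk : 1 ≤ k)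
    (hF : IsOptimal G k F) {u v w : V} (hv : IsFullStar F k v) (hu : u ∈ leafSet F v)
    (hwv : w ≠ v) (hw : w ∉ leafSet F v) (huw : G.Adj u w) :
    ∀ a ∈ leafSet F w, ∀ b ∈ leafSet F w, ¬ G.Adj a b := by
  intro a ha b hb hab
  have hwf := hF.full_of_adj hk hv hu hwv hw huw
  obtain ⟨F', hF', hw', -, -, hsame⟩ := hF.recentre hk hwf ha hb hab
  have hvb : v ≠ b := by rintro rfl; exact hv.not_leaf hk w hb
  obtain ⟨h1, h2⟩ := hsame v hwv.symm hvb
  exact hw' (hF'.full_of_adj hk (h1.2 hv) (h2 ▸ hu) hwv (h2 ▸ hw) huw)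

open Classical in
theorem IsOptimal.no_full {G F : SimpleGraph V} {k : ℕ} (hk : 1 ≤ k) (hG : G.Preconnected)
    (hV : 4 ≤ Fintype.card V)
    (h : ∀ S : Finset V, S.Nonempty → (isolatedAfter G S).card < (k + 1) * S.card)
    (hF : IsOptimal G k F) (v : V) : ¬ IsFullStar F k v := by
  intro hv
  -- If `S` is nonempty, every neighbour of a leaf of a star centred in `S` lies in `S`, so deleting
  -- `S` isolates `(k + 1) * S.card` leaves.
  set S := Finset.univ.filter fun x => IsFullStar F k x ∧
    ∀ a ∈ leafSet F x, ∀ b ∈ leafSet F x, ¬ G.Adj a b with hSdef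
  have hS : ∀ x, x ∈ S ↔ IsFullStar F k x ∧
      ∀ a ∈ leafSet F x, ∀ b ∈ leafSet F x, ¬ G.Adj a b := fun x => by simp [hSdef]
  rcases S.eq_empty_or_nonempty with hSe | hSn
  · have hnoS : ∀ x, IsFullStar F k x → ∃ a ∈ leafSet F x, ∃ b ∈ leafSet F x, G.Adj a b := by
      intro x hx
      by_contra! hno
      exact absurd ((hS x).2 ⟨hx, hno⟩) (by simp [hSe])
    obtain ⟨u, hu, u', hu', huu⟩ := hnoS v hv
    have hout : ∀ a ∈ leafSet F v, ∀ w, w ≠ v → w ∉ leafSet F v → ¬ G.Adj a w := by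
      intro a ha w hwv hw haw
      obtain ⟨b, hb, b', hb', hbb⟩ := hnoS w (hF.full_of_adj hk hv ha hwv hw haw)
      exact hF.independent_of_adj hk hv ha hwv hw haw b hb b' hb' hbb
    obtain ⟨F', hF', hv', huf', hleaf, hsame⟩ := hF.recentre hk hv hu hu' huu
    have hk1 : k = 1 := by
      have := huf'.1
      rw [hleaf, Finset.card_pair (mem_leafSet.1 hu).1.ne] at this
      omega
    have hlv : leafSet F v = {u, u'} := by
      refine (Finset.eq_of_subset_of_card_le ?_ ?_).symm
      · intro y hy
        rw [Finset.mem_insert, Finset.mem_singleton] at hy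
        rcases hy with rfl | rfl <;> assumption
      · rw [hv.1, Finset.card_pair huu.ne, hk1]
    -- Four vertices are needed: for `k = 1` the triangle meets the isolation condition, yet its
    -- spanning trees have leaf degree 2.
    obtain ⟨z, hz⟩ : ∃ z, z ∉ ({v, u, u'} : Finset V) := by
      by_contra! hall
      have h1 : Fintype.card V ≤ ({v, u, u'} : Finset V).card :=
        Finset.card_le_card fun x _ => hall x
      have h2 := Finset.card_le_three (a := v) (b := u) (c := u')
      omega
    obtain ⟨x, hx, y, hy, hxy⟩ := exists_adj_mem_notMem hG (Finset.mem_insert_self v _) hz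
    simp only [Finset.mem_insert, Finset.mem_singleton, not_or] at hx hy
    rcases hx with rfl | hx
    · have hyl : y ∉ leafSet F' u' := by
        rw [hleaf]; simp [hy.1, hy.2.1]
      have hxl : x ∈ leafSet F' u' := by rw [hleaf]; simp
      have hyf := hF'.full_of_adj hk huf' hxl hy.2.2 hyl hxy
      have hyi := hF'.independent_of_adj hk huf' hxl hy.2.2 hyl hxy
      obtain ⟨h1, h2⟩ := hsame y hy.1 hy.2.2
      obtain ⟨a, ha, b, hb, hab⟩ := hnoS y (h1.1 hyf)
      exact hyi a (h2 ▸ ha) b (h2 ▸ hb) hab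
    · refine hout x ?_ y hy.1 ?_ hxy
      · rw [hlv]; simpa using hx
      · rw [hlv]; simpa using hy.2
  · refine absurd (h S hSn) (not_lt.2 ?_)
    have hdisj : ((S : Set V)).PairwiseDisjoint (leafSet F) := by
      intro x _ y _ hxy
      rw [Function.onFun, Finset.disjoint_left]
      intro z hz hz'
      exact hxy ((mem_leafSet.1 hz').2 x (mem_leafSet.1 hz).1)
    have hcard : (S.biUnion (leafSet F)).card = (k + 1) * S.card := by
      rw [Finset.card_biUnion hdisj, Finset.sum_congr rfl fun x hx => ((hS x).1 hx).1.1,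
        Finset.sum_const, smul_eq_mul, mul_comm]
    rw [← hcard]
    refine Finset.card_le_card fun u hu => ?_
    obtain ⟨x, hx, hux⟩ := Finset.mem_biUnion.1 hu
    obtain ⟨hxf, hxi⟩ := (hS x).1 hx
    rw [mem_isolatedAfter]
    refine ⟨fun hus => ((hS u).1 hus).1.not_leaf hk x hux, fun w huw => ?_⟩
    by_cases hwx : w = x
    · exact hwx ▸ hx
    · have hwl : w ∉ leafSet F x := fun hw => hxi u hux w hw huw
      exact (hS w).2 ⟨hF.full_of_adj hk hxf hux hwx hwl huw,
        hF.independent_of_adj hk hxf hux hwx hwl huw⟩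

open Classical in
/-- Kaneko's theorem, the sufficiency of the isolation condition. -/
theorem hasSpanningTreeLeafDegreeLE_of_isolatedAfter {G : SimpleGraph V} {k : ℕ} (hk : 1 ≤ k)
    (hG : G.Connected) (hV : 4 ≤ Fintype.card V)
    (h : ∀ S : Finset V, S.Nonempty → (isolatedAfter G S).card < (k + 1) * S.card) :
    HasSpanningTreeLeafDegreeLE G k := by
  have : Nontrivial V := Fintype.one_lt_card_iff_nontrivial.1 (by omega)
  obtain ⟨F₀, hF₀⟩ := exists_isAlmostGood hk (fun v => hG.preconnected.exists_adj_of_nontrivial v)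
    (fun S hS => (h S hS).le)
  obtain ⟨F, hF, hmin⟩ := Finset.exists_min_image
    (Finset.univ.filter fun F : SimpleGraph V => IsAlmostGood G k F)
    (fun F => (fullCentres F k).card) ⟨F₀, by simpa using hF₀⟩
  simp only [Finset.mem_filter, Finset.mem_univ, true_and] at hF hmin
  have hopt : IsOptimal G k F := ⟨hF, hmin⟩
  obtain ⟨T, hFT, hTG, hT⟩ := hG.exists_isTree_le_of_le_of_isAcyclic hF.le hF.acyclic
  refine ⟨T, hTG, hT, Finset.sup_le fun v _ => ?_⟩
  rw [coe_leafSet, Set.ncard_coe_finset]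
  exact (Finset.card_le_card (leafSet_mono hF.exists_adj hFT v)).trans
    ((hF.leaf v).resolve_right (hopt.no_full hk hG.preconnected hV h v))

end Linking

/-- In a tree rooted at `r`, vertices with at least two neighbours have distinct children. -/
theorem exists_child {V : Type*} {T : SimpleGraph V} (hT : T.IsTree) (r : V) :
    ∃ parent : V → V, ∀ y a b, a ≠ b → T.Adj y a → T.Adj y b →
      ∃ z, T.Adj y z ∧ z ≠ r ∧ parent z = y := by
  -- The parent is the penultimate vertex of the path from `r`. For `r` itself this is `r` by
  -- default, so no neighbour is excluded there.
  choose P hP hPu using fun v => hT.existsUnique_path r v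
  refine ⟨fun v => (P v).penultimate, fun y a b hab ha hb => ?_⟩
  have key : ∀ z, T.Adj y z → z ≠ (P y).penultimate →
      ∃ z, T.Adj y z ∧ z ≠ r ∧ (P z).penultimate = y := by
    intro z hz hne
    have hzs : z ∉ (P y).support := fun h =>
      hne (hT.isAcyclic.eq_penultimate_of_adj_end (hP y) hz h)
    refine ⟨z, hz, ?_, ?_⟩
    · rintro rfl
      exact hzs (SimpleGraph.Walk.start_mem_support _)
    · rw [← hPu z ((P y).concat hz) ((hP y).concat hzs hz)]
      exact SimpleGraph.Walk.penultimate_concat _ _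
  by_cases h : a = (P y).penultimate
  · exact key b hb fun h' => hab (h.trans h'.symm)
  · exact key a ha h

/-! ### Necessity of the isolation condition -/

section Necessity

variable {V : Type*} [Fintype V]

theorem card_leafSet_le_leafDegree (T : SimpleGraph V) (v : V) :
    (leafSet T v).card ≤ leafDegree T := by
  rw [← Set.ncard_coe_finset, ← coe_leafSet]
  exact Finset.le_sup (f := fun v : V => {u : V | T.Adj v u ∧ IsEndVertex T u}.ncard)
    (Finset.mem_univ v)

open Classical in
/-- Kaneko's theorem, the necessity of the isolation condition. -/
theorem card_isolatedAfter_lt {G : SimpleGraph V} {k : ℕ}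
    (hG : HasSpanningTreeLeafDegreeLE G k) {S : Finset V} (hS : S.Nonempty) :
    (isolatedAfter G S).card < (k + 1) * S.card := by
  obtain ⟨T, hTG, hT, hleaf⟩ := hG
  obtain ⟨r, hr⟩ := hS
  obtain ⟨parent, hparent⟩ := exists_child hT r
  set I := isolatedAfter G S with hI
  have hIS : ∀ y ∈ I, ∀ z, T.Adj y z → z ∈ S := fun y hy z hz =>
    (mem_isolatedAfter.1 hy).2 z (hTG hz)
  have hnbr : ∀ y ∈ I, ∃ z, T.Adj y z := by
    intro y hy
    have : y ≠ r := by rintro rfl; exact (mem_isolatedAfter.1 hy).1 hr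
    have : Nontrivial V := ⟨y, r, this⟩
    exact hT.connected.preconnected.exists_adj_of_nontrivial y
  set L := S.biUnion (leafSet T)
  have h1 : (I.filter fun y => y ∈ L).card ≤ k * S.card := by
    calc _ ≤ L.card := Finset.card_le_card fun y hy => (Finset.mem_filter.1 hy).2
      _ ≤ ∑ x ∈ S, (leafSet T x).card := Finset.card_biUnion_le
      _ ≤ ∑ _x ∈ S, k :=
          Finset.sum_le_sum fun x _ => (card_leafSet_le_leafDegree T x).trans hleaf
      _ = k * S.card := by rw [Finset.sum_const, smul_eq_mul, mul_comm]
  have hchild : ∀ y ∈ I.filter fun y => y ∉ L, ∃ z, T.Adj y z ∧ z ≠ r ∧ parent z = y := by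
    intro y hy
    obtain ⟨hyI, hyL⟩ := Finset.mem_filter.1 hy
    obtain ⟨a, ha⟩ := hnbr y hyI
    have : ∃ b, T.Adj y b ∧ b ≠ a := by
      by_contra! hno
      exact hyL (Finset.mem_biUnion.2 ⟨a, hIS y hyI a ha, mem_leafSet.2 ⟨ha, hno⟩⟩)
    obtain ⟨b, hb, hba⟩ := this
    exact hparent y a b hba.symm ha hb
  -- Children of vertices of `I` lie in `S` and differ from the root, and distinct vertices have
  -- distinct children; this saves the one that makes the inequality strict.
  have h2 : (I.filter fun y => y ∉ L).card ≤ (S.erase r).card := by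
    refine (Finset.card_le_card (t := (S.erase r).image parent) fun y hy => ?_).trans
      Finset.card_image_le
    obtain ⟨z, hz, hzr, rfl⟩ := hchild y hy
    exact Finset.mem_image_of_mem _
      (Finset.mem_erase.2 ⟨hzr, hIS _ (Finset.mem_filter.1 hy).1 z hz⟩)
  have h3 := Finset.card_filter_add_card_filter_not (s := I) (fun y => y ∈ L)
  have h4 := Finset.card_erase_add_one hr
  rw [add_mul, one_mul]
  omega

open Classical in
theorem not_hasSpanningTree_of_iso {G : SimpleGraph V} {n k s : ℕ} (hs : 1 ≤ s)
    (e : G ≃g extremalGraph n k s) : ¬ HasSpanningTreeLeafDegreeLE G k := by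
  intro hG
  let S : Finset V := Finset.univ.map
    ⟨fun i : Fin s => e.symm (Sum.inl i), e.symm.injective.comp Sum.inl_injective⟩
  let I : Finset V := Finset.univ.map
    ⟨fun i : Fin ((k + 1) * s) => e.symm (Sum.inr (Sum.inr i)),
      e.symm.injective.comp (Sum.inr_injective.comp Sum.inr_injective)⟩
  have hS : ∀ v, v ∈ S ↔ ∃ i, e v = Sum.inl i := by
    intro v
    simp only [S, Finset.mem_map, Finset.mem_univ, true_and, Function.Embedding.coeFn_mk]
    exact exists_congr fun i => ⟨fun h => by rw [← h]; simp, fun h => by rw [← h]; simp⟩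
  have hcard : S.card = s := by simp [S]
  have hSn : S.Nonempty := Finset.card_pos.1 (by omega)
  refine absurd (card_isolatedAfter_lt hG hSn) (not_lt.2 ?_)
  have hI : I.card = (k + 1) * s := by simp [I]
  rw [hcard, ← hI]
  refine Finset.card_le_card fun v hv => ?_
  obtain ⟨i, -, rfl⟩ := Finset.mem_map.1 hv
  rw [mem_isolatedAfter]
  simp only [hS, Function.Embedding.coeFn_mk]
  refine ⟨by simp, fun w hw => ?_⟩
  rw [← e.map_adj_iff, e.apply_symm_apply] at hw
  rcases h : e w with j | j | j
  · exact ⟨j, rfl⟩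
  · rw [h] at hw; simp [extremalGraph, join] at hw
  · rw [h] at hw; simp [extremalGraph, join] at hw

end Necessity

/-! ### Embedding in an extremal graph and conclusion -/

section Main

variable {V : Type*} [Fintype V]

theorem IsTConnected.preconnected_induce {G : SimpleGraph V} {t : ℕ} (hG : IsTConnected G t)
    {S : Set V} (hS : S.ncard < t) : (G.induce Sᶜ).Preconnected := by
  by_contra h
  exact absurd (hG.trans (Nat.sInf_le ⟨S, rfl, Or.inl h⟩)) (not_le.2 hS)

theorem IsTConnected.preconnected {G : SimpleGraph V} {t : ℕ} (ht : 1 ≤ t)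
    (hG : IsTConnected G t) : G.Preconnected := by
  have h := hG.preconnected_induce (S := ∅) (by rw [Set.ncard_empty]; omega)
  intro a b
  obtain ⟨p⟩ := h ⟨a, by simp⟩ ⟨b, by simp⟩
  exact ⟨p.map (SimpleGraph.Embedding.induce _).toHom⟩

open Classical in
-- Two isolated vertices disconnect what remains after deleting `S`.
theorem IsTConnected.le_card {G : SimpleGraph V} {t : ℕ} (hG : IsTConnected G t) {S : Finset V}
    (hS : 2 ≤ (isolatedAfter G S).card) : t ≤ S.card := by
  by_contra! hlt
  have h := hG.preconnected_induce (S := (S : Set V)) (by rwa [Set.ncard_coe_finset])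
  obtain ⟨u, hu, v, hv, huv⟩ := Finset.one_lt_card.1 hS
  rw [mem_isolatedAfter] at hu hv
  obtain ⟨p⟩ := h ⟨u, by simpa using hu.1⟩ ⟨v, by simpa using hv.1⟩
  cases p with
  | nil => exact huv rfl
  | @cons _ w _ hadj _ => exact w.2 (hu.2 _ hadj)

open Classical in
theorem exists_bijective_of_partition {a b c : ℕ} {S I : Finset V}
    (hdisj : Disjoint S I) (hS : S.card = a) (hR : ((S ∪ I)ᶜ).card = b) (hI : I.card = c) :
    ∃ f : Fin a ⊕ (Fin b ⊕ Fin c) → V, Function.Bijective f ∧ (∀ i, f (Sum.inl i) ∈ S) ∧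
      (∀ i, f (Sum.inr (Sum.inl i)) ∈ (S ∪ I)ᶜ) ∧ ∀ i, f (Sum.inr (Sum.inr i)) ∈ I := by
  let eS := Finset.equivFinOfCardEq hS
  let eR := Finset.equivFinOfCardEq hR
  let eI := Finset.equivFinOfCardEq hI
  have hRS : ∀ v ∈ (S ∪ I)ᶜ, v ∉ S ∧ v ∉ I := fun v hv => by simpa using hv
  refine ⟨Sum.elim (fun i => eS.symm i) (Sum.elim (fun i => eR.symm i) fun i => eI.symm i), ?_,
    fun i => (eS.symm i).2, fun i => (eR.symm i).2, fun i => (eI.symm i).2⟩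
  rw [Fintype.bijective_iff_injective_and_card]
  constructor
  · refine Function.Injective.sumElim (Subtype.val_injective.comp eS.symm.injective)
      (Function.Injective.sumElim (Subtype.val_injective.comp eR.symm.injective)
        (Subtype.val_injective.comp eI.symm.injective) fun i j h => ?_) fun i j h => ?_
    · exact (hRS _ (eR.symm i).2).2 (h ▸ (eI.symm j).2)
    · have hi := (eS.symm i).2
      rw [h] at hi
      rcases j with j | j
      · exact (hRS _ (eR.symm j).2).1 hi
      · exact Finset.disjoint_left.1 hdisj hi (eI.symm j).2
  · have h1 := Finset.card_add_card_compl (S ∪ I)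
    rw [Finset.card_union_of_disjoint hdisj] at h1
    simp only [Fintype.card_sum, Fintype.card_fin]
    omega

open Classical in
/-- A graph with a set `S` whose deletion isolates many vertices is a spanning subgraph of an
extremal graph. -/
theorem exists_iso_le_extremalGraph {G : SimpleGraph V} {n k : ℕ} (hn : Fintype.card V = n)
    {S : Finset V} (hS : (k + 1) * S.card ≤ (isolatedAfter G S).card) :
    (k + 2) * S.card ≤ n ∧ ∃ G', G' ≤ extremalGraph n k S.card ∧ Nonempty (G ≃g G') := by
  -- Exactly `(k + 1) * S.card` isolated vertices are kept; any surplus goes into the clique block.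
  obtain ⟨I, hIsub, hIcard⟩ := Finset.exists_subset_card_eq hS
  have hdisj : Disjoint S I := Finset.disjoint_left.2 fun v hv hv' =>
    (mem_isolatedAfter.1 (hIsub hv')).1 hv
  have hunion : (S ∪ I).card = (k + 2) * S.card := by
    rw [Finset.card_union_of_disjoint hdisj, hIcard]; ring
  have hle : (k + 2) * S.card ≤ n := by
    rw [← hunion, ← hn]; exact Finset.card_le_univ _
  refine ⟨hle, ?_⟩
  have hR : ((S ∪ I)ᶜ).card = n - (k + 2) * S.card := by
    rw [Finset.card_compl, hunion, hn]
  obtain ⟨f, hbij, hfS, hfR, hfI⟩ := exists_bijective_of_partition hdisj rfl hR hIcard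
  have hRS : ∀ v ∈ (S ∪ I)ᶜ, v ∉ S ∧ v ∉ I := fun v hv => by simpa using hv
  refine ⟨G.comap f, ?_, ⟨(SimpleGraph.Iso.comap (Equiv.ofBijective f hbij) G).symm⟩⟩
  have hout : ∀ i x, G.Adj (f (Sum.inr (Sum.inr i))) (f x) → ∃ j, x = Sum.inl j := by
    intro i x hx
    have hxS := (mem_isolatedAfter.1 (hIsub (hfI i))).2 _ hx
    rcases x with j | j | j
    · exact ⟨j, rfl⟩
    · exact absurd hxS (hRS _ (hfR j)).1
    · exact absurd (hfI j) (Finset.disjoint_left.1 hdisj hxS)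
  intro a b hab
  have hne : a ≠ b := fun h => (G.comap f).irrefl (h ▸ hab)
  have hab' : G.Adj (f a) (f b) := hab
  rcases a with a | a | a <;> rcases b with b | b | b <;>
    first
    | (obtain ⟨j, hj⟩ := hout _ _ hab'; cases hj)
    | (obtain ⟨j, hj⟩ := hout _ _ hab'.symm; cases hj)
    | skip
  all_goals first | (simp [extremalGraph, join]; done) | simpa [extremalGraph, join] using hne

end Main

end LeafDegree

theorem theorem4p3 {V : Type*} [Fintype V] (G : SimpleGraph V) (n k t : ℕ)
    (hn : Fintype.card V = n) (hk : 1 ≤ k) (ht : 1 ≤ t) (hn4 : 4 ≤ n) (htn : (k + 2) * t ≤ n)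
    (hG : IsTConnected G t)
    (hlam : max (lambda1 (extremalGraph n k t)) (lambda1 (extremalGraph n k (n / (k + 2))))
      ≤ lambda1 G) :
    HasSpanningTreeLeafDegreeLE G k ↔
      ¬ Nonempty (G ≃g extremalGraph n k t) ∧
        ¬ Nonempty (G ≃g extremalGraph n k (n / (k + 2))) := by
  have hf : t ≤ n / (k + 2) := (Nat.le_div_iff_mul_le (by omega)).2 (by rwa [mul_comm])
  constructor
  · exact fun h => ⟨fun ⟨e⟩ => not_hasSpanningTree_of_iso ht e h,
      fun ⟨e⟩ => not_hasSpanningTree_of_iso (ht.trans hf) e h⟩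
  · rintro ⟨h1, h2⟩
    have : Nonempty V := Fintype.card_pos_iff.1 (by omega)
    refine hasSpanningTreeLeafDegreeLE_of_isolatedAfter hk ⟨hG.preconnected ht⟩ (by omega)
      fun S hS => ?_
    by_contra! hcard
    have hS1 : 1 ≤ S.card := Finset.card_pos.2 hS
    obtain ⟨hle, G', hG', ⟨e⟩⟩ := exists_iso_le_extremalGraph hn hcard
    have htS : t ≤ S.card := hG.le_card (le_trans (by nlinarith) hcard)
    have hSf : S.card ≤ n / (k + 2) := (Nat.le_div_iff_mul_le (by omega)).2 (by rwa [mul_comm])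
    obtain ⟨hlam1, heq⟩ := lambda1_le_extremalGraph hS1 hk hle hG'
    rw [lambda1_iso e] at hlam
    obtain ⟨hlamt, hlamf⟩ := max_le_iff.1 hlam
    rcases htS.eq_or_lt with hs | hs
    · rw [hs] at h1 hlamt
      rw [heq hlamt] at e
      exact h1 ⟨e⟩
    · rcases hSf.eq_or_lt with hs' | hs'
      · rw [← hs'] at h2 hlamf
        rw [heq hlamf] at e
        exact h2 ⟨e⟩
      · have := lambda1_extremalGraph_lt_max hk ht hs hs' (Nat.mul_div_le n (k + 2))
        exact absurd (hlam.trans hlam1) (not_le.2 this)
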